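/- Let $O$ be a convex polygon in the plane: the obstacle is its open interior region, and the free space is $F=\mathbb{R}^2\setminus O$, so that the boundary of the polygon belongs to $F$. A point $x\in F$ is visible from $y\in F$ if the segment $\overline{xy}$ does not meet the open region $O$. A path is a continuous map $f:[0,1]\to F$; it is a watchman route starting at $s$ if $f(0)=s$ and every point of $F$ is visible from some point of $f([0,1])$. Let $\mathrm{OPT}(O,s)$ be the minimal (infimal) length of a watchman route around $O$ starting at $s$. For a path $f$ let $v_f(t)$ be the set of vertices of $O$ that are visible from some point of $f([0,t])$. An online watchman algorithm is a function $h$ of a starting point, a set of seen vertices and a time $t\in[0,1]$ such that for every convex polygon $O$ and every starting point $s\in F$ there is a watchman route $f$ for $O$ starting at $s$ with $f(t)=h(s,v_f(t),t)$ for all $t\in[0,1]$. Then for every online watchman algorithm $h$ and every $\varepsilon>0$ there are a triangular obstacle $O$, with two sides of equal length $\ell$ and third side of length at most $\varepsilon\ell$, and a starting point $s\in F$, such that $0<\mathrm{OPT}(O,s)<\infty$ and every watchman route $f$ for $O$ starting at $s$ with $f(t)=h(s,v_f(t),t)$ for all $t\in[0,1]$ (at least one such route exists) satisfies $$\frac{\mathrm{length}(f)}{\mathrm{OPT}(O,s)}>3-\varepsilon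 .$$ -/

import Mathlib

open Set
open scoped ENNReal

namespace Watchman

/-- The Euclidean plane. -/
abbrev Plane : Type := EuclideanSpace ℝ (Fin 2)

/-- A (nondegenerate) convex polygon, given by its vertices: at least three points, none of which
lies in the convex hull of the others. -/
structure ConvexPolygon where
  vertices : Finset Plane
  three_le_card : 3 ≤ vertices.card
  convexIndependent : ConvexIndependent ℝ (fun v : vertices => (v : Plane))

namespace ConvexPolygon

variable (O : ConvexPolygon)

/-- The region that blocks motion and sight: the open polygonal region. The robot may touch and
walk along the edges, and the vertices are points that can be seen. -/
def obstacle : Set Plane := interior (convexHull ℝ (O.vertices : Set Plane))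

/-- The free space, the complement of the obstacle. -/
def free : Set Plane := O.obstacleᶜ

/-- The set of points of the free space visible from some point of `S`. -/
def visible (S : Set Plane) : Set Plane :=
  {x | x ∈ O.free ∧ ∃ y ∈ S, segment ℝ x y ∩ O.obstacle = ∅}

/-- `f`, restricted to `[0,1]`, is a path in the free space. -/
def IsPath (f : ℝ → Plane) : Prop :=
  ContinuousOn f (Icc 0 1) ∧ MapsTo f (Icc 0 1) O.free

/-- `f` is a watchman route with starting point `s`: a path in the free space that starts at `s`
and from which all of the free space is seen. -/
def IsWatchmanRoute (s : Plane) (f : ℝ → Plane) : Prop :=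
  O.IsPath f ∧ f 0 = s ∧ O.visible (f '' Icc 0 1) = O.free

/-- The vertices seen from the path `f` up to (and including) time `t`. -/
def seenVertices (f : ℝ → Plane) (t : ℝ) : Set Plane :=
  (O.vertices : Set Plane) ∩ O.visible (f '' Icc 0 t)

end ConvexPolygon

/-- The length of a path on `[0,1]` (infinite if the path is not rectifiable). -/
noncomputable def pathLength (f : ℝ → Plane) : ℝ≥0∞ := eVariationOn f (Icc 0 1)

/-- The offline optimum: the least length of a watchman route around `O` starting at `s`. -/
noncomputable def opt (O : ConvexPolygon) (s : Plane) : ℝ≥0∞ :=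
  ⨅ (f : ℝ → Plane) (_ : O.IsWatchmanRoute s f), pathLength f

/-- `f` is a watchman route that the strategy `h` produces on the polygon `O` from the start `s`:
at every time `t` the position is determined by `s`, the set of vertices seen so far, and `t`. -/
def IsOnlineRoute (h : Plane → Set Plane → ℝ → Plane) (O : ConvexPolygon) (s : Plane)
    (f : ℝ → Plane) : Prop :=
  O.IsWatchmanRoute s f ∧ ∀ t ∈ Icc (0 : ℝ) 1, f t = h s (O.seenVertices f t) t

/-- An online watchman route algorithm: a function `h` of the starting point, the set of vertices
seen so far and the time, which produces a watchman route for every convex polygon and every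
starting point in its free space. -/
def IsOnlineWatchmanAlgorithm (h : Plane → Set Plane → ℝ → Plane) : Prop :=
  ∀ (O : ConvexPolygon) (s : Plane), s ∈ O.free → ∃ f : ℝ → Plane, IsOnlineRoute h O s f

end Watchman

namespace Watchman

/-! The start is the origin, the midpoint of a long side lying on the horizontal axis. The two
mirror-image thin triangles, σ = 1 and σ = -1, share this side and lie below it, with the short side
at opposite ends. Here `u` is the tangent of half the apex angle. From the origin exactly the two
ends of the shared side are visible, so the algorithm cannot tell the triangles apart until its
route leaves one of the cones `hiddenCone` (`IsExitTime.eq_strategy`).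

At the first such exit the route is in the closed upper half-plane and has moved horizontally by
about one unit, to one side. The adversary picks the triangle whose short side is at the other end.
To see the midpoint of that side the route must reach the side's line (`exists_one_le_baseForm`),
which costs about two more units. The total is at least 3/√(1+u²) (`exists_sign`), while walking
directly to the short side and along it costs at most 1+4u (`opt_triangle_le`). Let u tend to 0. -/

/-- A linear functional whose level `1` is the line through the short side. -/
noncomputable def baseForm (u σ : ℝ) (v : Plane) : ℝ := σ * v 0 - u * v 1

/-- An affine functional vanishing on the long side that does not contain the origin. -/
noncomputable def legForm (u σ : ℝ) (v : Plane) : ℝ :=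
  2 * u * (σ * v 0 + 1) + (1 - u ^ 2) * v 1

/-- The apex of the thin triangle. -/
noncomputable def apex (σ : ℝ) : Plane := !₂[-σ, 0]

/-- The endpoint of the short side that is visible from the origin. -/
noncomputable def near (σ : ℝ) : Plane := !₂[σ, 0]

/-- The endpoint of the short side that is hidden from the origin. -/
noncomputable def far (u σ : ℝ) : Plane :=
  !₂[σ * ((1 - 3 * u ^ 2) / (1 + u ^ 2)), -(4 * u / (1 + u ^ 2))]

/-- The open cone of points from which the hidden vertex is not visible. -/
def hiddenCone (u σ : ℝ) : Set Plane := {v | baseForm u σ v < 1 ∧ 0 < legForm u σ v}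

/-! ### Affine forms of the side lines and their values at the vertices -/

section Forms

variable {u σ : ℝ}

@[simp] lemma apex_zero : apex σ 0 = -σ := by simp [apex]
@[simp] lemma apex_one : apex σ 1 = 0 := by simp [apex]
@[simp] lemma near_zero : near σ 0 = σ := by simp [near]
@[simp] lemma near_one : near σ 1 = 0 := by simp [near]
@[simp] lemma far_zero : far u σ 0 = σ * ((1 - 3 * u ^ 2) / (1 + u ^ 2)) := by simp [far]
@[simp] lemma far_one : far u σ 1 = -(4 * u / (1 + u ^ 2)) := by simp [far]

lemma baseForm_combo (a b : ℝ) (v w : Plane) :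
    baseForm u σ (a • v + b • w) = a * baseForm u σ v + b * baseForm u σ w := by
  simp [baseForm]; ring

lemma legForm_combo {a b : ℝ} (hab : a + b = 1) (v w : Plane) :
    legForm u σ (a • v + b • w) = a * legForm u σ v + b * legForm u σ w := by
  obtain rfl : b = 1 - a := by linarith
  simp [legForm]; ring

lemma snd_combo (a b : ℝ) (v w : Plane) : (a • v + b • w) 1 = a * v 1 + b * w 1 := by simp

lemma continuous_baseForm : Continuous (baseForm u σ) := by
  unfold baseForm; fun_prop

lemma continuous_legForm : Continuous (legForm u σ) := by
  unfold legForm; fun_prop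

lemma isOpen_hiddenCone : IsOpen (hiddenCone u σ) :=
  (isOpen_lt continuous_baseForm continuous_const).inter
    (isOpen_lt continuous_const continuous_legForm)

lemma baseForm_apex (hσ : σ ^ 2 = 1) : baseForm u σ (apex σ) = -1 := by
  simp [baseForm]; linarith

lemma baseForm_near (hσ : σ ^ 2 = 1) : baseForm u σ (near σ) = 1 := by
  simp [baseForm]; linarith

lemma baseForm_far (hσ : σ ^ 2 = 1) : baseForm u σ (far u σ) = 1 := by
  have : 1 + u ^ 2 ≠ 0 := by positivity
  simp only [baseForm, far_zero, far_one]
  rw [← mul_assoc, ← sq, hσ]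
  field_simp
  ring

lemma legForm_apex (hσ : σ ^ 2 = 1) : legForm u σ (apex σ) = 0 := by
  have : σ * σ = 1 := by linarith
  simp [legForm, this]

lemma legForm_near (hσ : σ ^ 2 = 1) : legForm u σ (near σ) = 4 * u := by
  have : σ * σ = 1 := by linarith
  simp [legForm, this]; ring

lemma legForm_far (hσ : σ ^ 2 = 1) : legForm u σ (far u σ) = 0 := by
  have : 1 + u ^ 2 ≠ 0 := by positivity
  simp only [legForm, far_zero, far_one]
  rw [← mul_assoc σ σ, ← sq σ, hσ]
  field_simp
  ring

lemma far_one_neg (hu : 0 < u) : far u σ 1 < 0 := by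
  rw [far_one]; have : 0 < 4 * u / (1 + u ^ 2) := by positivity
  linarith

lemma convex_le_baseForm (c : ℝ) : Convex ℝ {v | c ≤ baseForm u σ v} := by
  intro v hv w hw a b ha hb hab
  simp only [mem_ofPred_eq, baseForm_combo] at *
  have hc : c = a * c + b * c := by rw [← add_mul, hab, one_mul]
  linarith [mul_le_mul_of_nonneg_left hv ha, mul_le_mul_of_nonneg_left hw hb]

lemma convex_baseForm_le (c : ℝ) : Convex ℝ {v | baseForm u σ v ≤ c} := by
  intro v hv w hw a b ha hb hab
  simp only [mem_ofPred_eq, baseForm_combo] at *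
  have hc : c = a * c + b * c := by rw [← add_mul, hab, one_mul]
  linarith [mul_le_mul_of_nonneg_left hv ha, mul_le_mul_of_nonneg_left hw hb]

lemma convex_le_legForm (c : ℝ) : Convex ℝ {v | c ≤ legForm u σ v} := by
  intro v hv w hw a b ha hb hab
  simp only [mem_ofPred_eq, legForm_combo hab] at *
  have hc : c = a * c + b * c := by rw [← add_mul, hab, one_mul]
  linarith [mul_le_mul_of_nonneg_left hv ha, mul_le_mul_of_nonneg_left hw hb]

lemma convex_legForm_le (c : ℝ) : Convex ℝ {v | legForm u σ v ≤ c} := by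
  intro v hv w hw a b ha hb hab
  simp only [mem_ofPred_eq, legForm_combo hab] at *
  have hc : c = a * c + b * c := by rw [← add_mul, hab, one_mul]
  linarith [mul_le_mul_of_nonneg_left hv ha, mul_le_mul_of_nonneg_left hw hb]

lemma convex_le_snd (c : ℝ) : Convex ℝ {v : Plane | c ≤ v 1} := by
  intro v hv w hw a b ha hb hab
  simp only [mem_ofPred_eq, snd_combo] at *
  have hc : c = a * c + b * c := by rw [← add_mul, hab, one_mul]
  linarith [mul_le_mul_of_nonneg_left hv ha, mul_le_mul_of_nonneg_left hw hb]

lemma convex_snd_le (c : ℝ) : Convex ℝ {v : Plane | v 1 ≤ c} := by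
  intro v hv w hw a b ha hb hab
  simp only [mem_ofPred_eq, snd_combo] at *
  have hc : c = a * c + b * c := by rw [← add_mul, hab, one_mul]
  linarith [mul_le_mul_of_nonneg_left hv ha, mul_le_mul_of_nonneg_left hw hb]

end Forms

/-! ### The triangle, its free space and visibility -/

section Triangle

variable {u σ : ℝ}

lemma apex_ne_near (hσ : σ ^ 2 = 1) : apex σ ≠ near σ := fun h => by
  have := congrArg (baseForm 0 σ) h
  rw [baseForm_apex hσ, baseForm_near hσ] at this
  norm_num at this

lemma apex_ne_far (hu : 0 < u) : apex σ ≠ far u σ := fun h => by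
  have := far_one_neg (σ := σ) hu
  rw [← h, apex_one] at this
  exact this.false

lemma near_ne_far (hu : 0 < u) : near σ ≠ far u σ := fun h => by
  have := far_one_neg (σ := σ) hu
  rw [← h, near_one] at this
  exact this.false

/-- Each vertex is cut off from the other two by a half-plane bounded by the line of the opposite
side. -/
lemma convexIndependent_triangle (hu : 0 < u) (hσ : σ ^ 2 = 1) :
    ConvexIndependent ℝ ((↑) : ({apex σ, near σ, far u σ} : Set Plane) → Plane) := by
  rw [convexIndependent_set_iff_notMem_convexHull_sdiff]
  have key : ∀ (x : Plane) (S : Set Plane), Convex ℝ S → x ∉ S →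
      (∀ y ∈ ({apex σ, near σ, far u σ} : Set Plane), y ≠ x → y ∈ S) →
      x ∉ convexHull ℝ (({apex σ, near σ, far u σ} : Set Plane) \ {x}) :=
    fun x S hS hx h hmem => hx (convexHull_min (fun y hy => h y hy.1 hy.2) hS hmem)
  have hA := baseForm_apex (u := u) hσ
  have hB := baseForm_near (u := u) hσ
  have hC := baseForm_far (u := u) hσ
  have hA' := legForm_apex (u := u) hσ
  have hB' := legForm_near (u := u) hσ
  have hC' := legForm_far (u := u) hσ
  rintro x (rfl | rfl | rfl)
  · refine key _ _ (convex_le_baseForm (u := u) (σ := σ) 1) (by simp [hA]) ?_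
    rintro y (rfl | rfl | rfl) hy
    · exact absurd rfl hy
    · exact hB.ge
    · exact hC.ge
  · refine key _ _ (convex_legForm_le (u := u) (σ := σ) 0) (by simp [hB', hu]) ?_
    rintro y (rfl | rfl | rfl) hy
    · exact hA'.le
    · exact absurd rfl hy
    · exact hC'.le
  · refine key _ _ (convex_le_snd 0) (not_le.2 (far_one_neg hu)) ?_
    rintro y (rfl | rfl | rfl) hy
    · exact apex_one.ge
    · exact near_one.ge
    · exact absurd rfl hy

open Classical in
/-- The thin isosceles triangle. -/
noncomputable def triangle (u σ : ℝ) (hu : 0 < u) (hσ : σ ^ 2 = 1) : ConvexPolygon where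
  vertices := {apex σ, near σ, far u σ}
  three_le_card := (Finset.card_eq_three.2
    ⟨_, _, _, apex_ne_near hσ, apex_ne_far hu, near_ne_far hu, rfl⟩).ge
  convexIndependent := by
    have h := convexIndependent_triangle hu hσ
    have e : (({apex σ, near σ, far u σ} : Finset Plane) : Set Plane)
        = {apex σ, near σ, far u σ} := by simp
    rw [← e] at h
    exact h

variable (hu : 0 < u) (hσ : σ ^ 2 = 1)

lemma coe_vertices_triangle :
    ((triangle u σ hu hσ).vertices : Set Plane) = {apex σ, near σ, far u σ} := by
  simp [triangle]

lemma mem_convexHull_triangle (hu : 0 < u) (hσ : σ ^ 2 = 1) {v : Plane} (h1 : v 1 ≤ 0)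
    (h2 : baseForm u σ v ≤ 1)
    (h3 : 0 ≤ legForm u σ v) : v ∈ convexHull ℝ {apex σ, near σ, far u σ} := by
  -- Barycentric coordinates: each weight is the form of the opposite side, normalised to be 1 at
  -- its vertex.
  have hw : v = ((1 - baseForm u σ v) / 2) • apex σ + (legForm u σ v / (4 * u)) • near σ
      + (-(v 1) * (1 + u ^ 2) / (4 * u)) • far u σ := by
    have : 1 + u ^ 2 ≠ 0 := by positivity
    have hu' := hu.ne'
    ext i
    fin_cases i
    · simp [baseForm, legForm]
      field_simp
      linear_combination (-(8 * u * v 0)) * hσ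
    · simp [baseForm, legForm]
      field_simp
  have hsum : (1 - baseForm u σ v) / 2 + legForm u σ v / (4 * u)
      + -(v 1) * (1 + u ^ 2) / (4 * u) = 1 := by
    have hu' := hu.ne'
    simp only [baseForm, legForm]
    field_simp
    ring
  have hS := convex_convexHull ℝ ({apex σ, near σ, far u σ} : Set Plane)
  have := hS.sum_mem (t := (Finset.univ : Finset (Fin 3)))
    (w := ![(1 - baseForm u σ v) / 2, legForm u σ v / (4 * u), -(v 1) * (1 + u ^ 2) / (4 * u)])
    (z := ![apex σ, near σ, far u σ]) ?_ ?_ ?_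
  · simp only [Fin.sum_univ_three, Matrix.cons_val] at this
    rwa [← hw] at this
  · intro i _
    fin_cases i
    · simp; linarith
    · simp; positivity
    · have : 0 ≤ -(v 1) := by linarith
      simp only [Fin.reduceFinMk, Matrix.cons_val]; positivity
  · simpa [Fin.sum_univ_three] using hsum
  · intro i _
    apply subset_convexHull
    fin_cases i <;> simp

/-- The linear functional with the given coefficients. -/
noncomputable def coordForm (a b : ℝ) : Plane →L[ℝ] ℝ :=
  a • EuclideanSpace.proj 0 + b • EuclideanSpace.proj 1

lemma coordForm_apply (a b : ℝ) (v : Plane) : coordForm a b v = a * v 0 + b * v 1 := by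
  simp [coordForm]

/-- A nonzero functional is surjective, hence open, so taking preimages commutes with interior. -/
lemma interior_coordForm_le {a b : ℝ} (h : a ≠ 0 ∨ b ≠ 0) (c : ℝ) :
    interior {v | coordForm a b v ≤ c} = {v | coordForm a b v < c} := by
  have hs : Function.Surjective (coordForm a b) := by
    intro r
    rcases h with h | h
    · exact ⟨!₂[r / a, 0], by simp [coordForm_apply]; field_simp⟩
    · exact ⟨!₂[0, r / b], by simp [coordForm_apply]; field_simp⟩
  have := ((coordForm a b).isOpenMap hs).preimage_interior_eq_interior_preimage
    (coordForm a b).continuous (Iic c)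
  rw [interior_Iic] at this
  exact this.symm

lemma obstacle_triangle : (triangle u σ hu hσ).obstacle =
    {v | v 1 < 0 ∧ baseForm u σ v < 1 ∧ 0 < legForm u σ v} := by
  rw [ConvexPolygon.obstacle, coe_vertices_triangle]
  have hσ0 : σ ≠ 0 := by rintro rfl; norm_num at hσ
  apply Subset.antisymm
  · have h1 : convexHull ℝ {apex σ, near σ, far u σ} ⊆ {v | coordForm 0 1 v ≤ 0} := by
      have : {v | coordForm 0 1 v ≤ 0} = {v : Plane | v 1 ≤ 0} := by simp [coordForm_apply]
      rw [this]
      refine convexHull_min ?_ (convex_snd_le 0)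
      rintro y (rfl | rfl | rfl)
      · exact apex_one.le
      · exact near_one.le
      · exact (far_one_neg hu).le
    have h2 : convexHull ℝ {apex σ, near σ, far u σ} ⊆ {v | coordForm σ (-u) v ≤ 1} := by
      have : {v | coordForm σ (-u) v ≤ 1} = {v : Plane | baseForm u σ v ≤ 1} := by
        simp [coordForm_apply, baseForm, sub_eq_add_neg]
      rw [this]
      refine convexHull_min ?_ (convex_baseForm_le 1)
      rintro y (rfl | rfl | rfl)
      · simp [baseForm_apex hσ]
      · simp [baseForm_near hσ]
      · simp [baseForm_far hσ]
    have h3 : convexHull ℝ {apex σ, near σ, far u σ} ⊆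
        {v | coordForm (-(2 * u * σ)) (-(1 - u ^ 2)) v ≤ 2 * u} := by
      have : {v | coordForm (-(2 * u * σ)) (-(1 - u ^ 2)) v ≤ 2 * u}
          = {v : Plane | 0 ≤ legForm u σ v} := by
        ext v
        simp only [coordForm_apply, legForm, mem_ofPred_eq]
        constructor <;> intro h <;> linarith
      rw [this]
      refine convexHull_min ?_ (convex_le_legForm 0)
      rintro y (rfl | rfl | rfl)
      · simp [legForm_apex hσ]
      · simp [legForm_near hσ, hu.le]
      · simp [legForm_far hσ]
    intro v hv
    have k1 := interior_mono h1 hv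
    have k2 := interior_mono h2 hv
    have k3 := interior_mono h3 hv
    rw [interior_coordForm_le (by simp)] at k1
    rw [interior_coordForm_le (by simp [hσ0])] at k2
    rw [interior_coordForm_le (by simp [hσ0, hu.ne'])] at k3
    simp only [coordForm_apply, mem_ofPred_eq] at k1 k2 k3
    refine ⟨by linarith, ?_, ?_⟩
    · simp only [baseForm]; linarith
    · simp only [legForm]; linarith
  · apply interior_maximal
    · rintro v ⟨h1, h2, h3⟩
      exact mem_convexHull_triangle hu hσ h1.le h2.le h3.le
    · have h : Continuous fun v : Plane => v 1 := by fun_prop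
      exact (isOpen_lt h continuous_const).inter isOpen_hiddenCone

lemma mem_free_triangle {v : Plane} : v ∈ (triangle u σ hu hσ).free ↔
    0 ≤ v 1 ∨ 1 ≤ baseForm u σ v ∨ legForm u σ v ≤ 0 := by
  rw [ConvexPolygon.free, mem_compl_iff, obstacle_triangle, mem_ofPred_eq]
  simp only [not_and_or, not_lt]

lemma segment_inter_obstacle_eq_empty {S : Set Plane} (hS : Convex ℝ S)
    (hSf : S ⊆ (triangle u σ hu hσ).free) {x y : Plane} (hx : x ∈ S) (hy : y ∈ S) :
    segment ℝ x y ∩ (triangle u σ hu hσ).obstacle = ∅ := by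
  rw [← disjoint_iff_inter_eq_empty, ← subset_compl_iff_disjoint_right]
  exact (hS.segment_subset hx hy).trans hSf

/-- From a point strictly on the inner side of the short side's line, no point of that side other
than the near vertex is visible; for the far vertex this needs the point to lie strictly on the
inner side of the leg as well. -/
lemma segment_inter_obstacle_nonempty {x w : Plane} (hx : x 1 < 0) (hxb : baseForm u σ x = 1)
    (hxl : 0 ≤ legForm u σ x) (hwb : baseForm u σ w < 1)
    (hwl : 0 < legForm u σ x ∨ 0 < legForm u σ w) :
    (segment ℝ x w ∩ (triangle u σ hu hσ).obstacle).Nonempty := by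
  -- The blocking point is found just after `x`: the strict inequalities persist for small δ, and
  -- the other two become strict on moving towards `w`.
  obtain ⟨δ, hδ0, hδ1, h1, h2⟩ : ∃ δ : ℝ, 0 < δ ∧ δ < 1 ∧ (1 - δ) * x 1 + δ * w 1 < 0 ∧
      0 < (1 - δ) * legForm u σ x + δ * legForm u σ w := by
    have c1 : ∀ᶠ δ in nhdsWithin (0 : ℝ) (Ioi 0), (1 - δ) * x 1 + δ * w 1 < 0 := by
      apply nhdsWithin_le_nhds
      have : Continuous fun δ : ℝ => (1 - δ) * x 1 + δ * w 1 := by fun_prop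
      exact this.continuousAt.eventually_lt continuousAt_const (by simpa using hx)
    have c2 : ∀ᶠ δ in nhdsWithin (0 : ℝ) (Ioi 0),
        0 < (1 - δ) * legForm u σ x + δ * legForm u σ w := by
      rcases hxl.eq_or_lt with h | h
      · have hw : 0 < legForm u σ w := by
          rcases hwl with h' | h'
          · exact absurd h h'.ne
          · exact h'
        filter_upwards [self_mem_nhdsWithin] with δ hδ
        have : (0 : ℝ) < δ := hδ
        rw [← h]; simp; positivity
      · apply nhdsWithin_le_nhds
        have : Continuous fun δ : ℝ => (1 - δ) * legForm u σ x + δ * legForm u σ w := by fun_prop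
        exact continuousAt_const.eventually_lt this.continuousAt (by simpa using h)
    have c3 : ∀ᶠ δ in nhdsWithin (0 : ℝ) (Ioi 0), δ ∈ Ioo (0 : ℝ) 1 :=
      Ioo_mem_nhdsGT one_pos
    obtain ⟨δ, ⟨h1, h2⟩, h3⟩ := ((c1.and c2).and c3).exists
    exact ⟨δ, h3.1, h3.2, h1, h2⟩
  refine ⟨(1 - δ) • x + δ • w, ⟨1 - δ, δ, by linarith, hδ0.le, by ring, rfl⟩, ?_⟩
  rw [obstacle_triangle, mem_ofPred_eq, snd_combo, baseForm_combo, legForm_combo (by ring), hxb]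
  exact ⟨h1, by nlinarith, h2⟩

lemma far_notMem_visible {S : Set Plane} (hS : S ⊆ hiddenCone u σ) :
    far u σ ∉ (triangle u σ hu hσ).visible S := by
  rintro ⟨-, y, hy, he⟩
  have := segment_inter_obstacle_nonempty hu hσ (far_one_neg hu) (baseForm_far hσ)
    (legForm_far hσ).ge (hS hy).1 (Or.inr (hS hy).2)
  exact this.ne_empty he

/-- The midpoint of the short side must be seen, and it is visible only from points on or beyond
that side's line. -/
lemma exists_one_le_baseForm {s : Plane} {f : ℝ → Plane}
    (hf : (triangle u σ hu hσ).IsWatchmanRoute s f) :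
    ∃ t ∈ Icc (0 : ℝ) 1, 1 ≤ baseForm u σ (f t) := by
  set m : Plane := (1 / 2 : ℝ) • near σ + (1 / 2 : ℝ) • far u σ with hm
  have hmb : baseForm u σ m = 1 := by
    rw [hm, baseForm_combo, baseForm_near hσ, baseForm_far hσ]; norm_num
  have hml : 0 < legForm u σ m := by
    rw [hm, legForm_combo (by norm_num), legForm_near hσ, legForm_far hσ]; linarith
  have hm1 : m 1 < 0 := by
    rw [hm, snd_combo, near_one]; linarith [far_one_neg (σ := σ) hu]
  have hmem : m ∈ (triangle u σ hu hσ).visible (f '' Icc 0 1) := by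
    rw [hf.2.2, mem_free_triangle]; exact Or.inr (Or.inl hmb.ge)
  obtain ⟨-, _, ⟨t, ht, rfl⟩, he⟩ := hmem
  refine ⟨t, ht, ?_⟩
  by_contra! hlt
  exact (segment_inter_obstacle_nonempty hu hσ hm1 hmb hml.le hlt (Or.inl hml)).ne_empty he

lemma upper_subset_free : {v : Plane | 0 ≤ v 1} ⊆ (triangle u σ hu hσ).free :=
  fun _ hv => (mem_free_triangle hu hσ).2 (Or.inl hv)

/-- This set is the same for σ and -σ, so it carries no information about which triangle is present.
-/
lemma seenVertices_eq {f : ℝ → Plane} (h0 : f 0 = 0) {t : ℝ} (ht : 0 ≤ t)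
    (hf : f '' Icc 0 t ⊆ hiddenCone u σ) :
    (triangle u σ hu hσ).seenVertices f t = {apex σ, near σ} := by
  have hmem : (0 : Plane) ∈ f '' Icc 0 t := ⟨0, ⟨le_rfl, ht⟩, h0⟩
  have hsee : ∀ v : Plane, 0 ≤ v 1 → v ∈ (triangle u σ hu hσ).visible (f '' Icc 0 t) :=
    fun v hv => ⟨upper_subset_free hu hσ hv, 0, hmem,
      segment_inter_obstacle_eq_empty hu hσ (convex_le_snd 0)
        (upper_subset_free hu hσ) hv (by simp)⟩
  rw [ConvexPolygon.seenVertices, coe_vertices_triangle]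
  apply Subset.antisymm
  · rintro y ⟨rfl | rfl | rfl, hy⟩
    · simp
    · simp
    · exact absurd hy (far_notMem_visible hu hσ hf)
  · rintro y (rfl | rfl)
    · exact ⟨by simp, hsee _ apex_one.ge⟩
    · exact ⟨by simp, hsee _ near_one.ge⟩

end Triangle

/-! ### Lower and upper bounds for path length -/

section Length

variable {u σ : ℝ}

/-- Cauchy–Schwarz: the gradient (σ, -u) has norm √(1+u²). -/
lemma abs_baseForm_sub_le (hσ : σ ^ 2 = 1) (v w : Plane) :
    |baseForm u σ v - baseForm u σ w| ≤ √(1 + u ^ 2) * dist v w := by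
  rw [EuclideanSpace.dist_eq, ← Real.sqrt_mul (by positivity)]
  apply Real.abs_le_sqrt
  simp only [Fin.sum_univ_two, Real.dist_eq, sq_abs, baseForm]
  nlinarith [sq_nonneg (σ * (v 1 - w 1) + u * (v 0 - w 0)), sq_nonneg (v 0 - w 0),
    sq_nonneg (v 1 - w 1)]

lemma div_le_dist (hσ : σ ^ 2 = 1) {v w : Plane} {c : ℝ}
    (h : c ≤ |baseForm u σ v - baseForm u σ w|) : c / √(1 + u ^ 2) ≤ dist v w := by
  rw [div_le_iff₀ (by positivity), mul_comm]
  exact h.trans (abs_baseForm_sub_le hσ v w)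

lemma ofReal_dist_add_dist_le_pathLength (f : ℝ → Plane) {a b : ℝ} (ha : 0 ≤ a) (hab : a ≤ b)
    (hb : b ≤ 1) :
    ENNReal.ofReal (dist (f 0) (f a) + dist (f a) (f b)) ≤ pathLength f := by
  rw [ENNReal.ofReal_add dist_nonneg dist_nonneg, ← edist_dist, ← edist_dist, pathLength]
  have h1 : edist (f 0) (f a) ≤ eVariationOn f (Icc 0 1 ∩ Icc 0 a) :=
    eVariationOn.edist_le f ⟨⟨le_rfl, by linarith⟩, le_rfl, ha⟩ ⟨⟨ha, hab.trans hb⟩, ha, le_rfl⟩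
  have h2 : edist (f a) (f b) ≤ eVariationOn f (Icc 0 1 ∩ Icc a 1) :=
    eVariationOn.edist_le f ⟨⟨ha, hab.trans hb⟩, le_rfl, hab.trans hb⟩
      ⟨⟨ha.trans hab, hb⟩, hab, hb⟩
  refine (add_le_add h1 h2).trans ?_
  have h3 := eVariationOn.Icc_add_Icc f (s := Icc 0 1) ha (hab.trans hb) ⟨ha, hab.trans hb⟩
  rw [h3]
  exact eVariationOn.mono f inter_subset_left

lemma eVariationOn_lineMap_le (p q : Plane) {a b k c : ℝ} (hab : a ≤ b) (hk : 0 ≤ k) :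
    eVariationOn (fun t => AffineMap.lineMap p q (k * t + c)) (Icc a b) ≤
      ENNReal.ofReal (k * (b - a) * dist p q) := by
  have hl : LipschitzOnWith (nndist p q) (AffineMap.lineMap p q : ℝ → Plane) univ :=
    (lipschitzWith_lineMap p q).lipschitzOnWith
  have h := hl.comp_eVariationOn_le (f := AffineMap.lineMap p q)
    (g := fun t : ℝ => k * t + c) (s := Icc a b) (mapsTo_univ _ _)
  have hm : MonotoneOn (fun t : ℝ => k * t + c) (Icc a b) :=
    fun x _ y _ hxy => by have := mul_le_mul_of_nonneg_left hxy hk; simpa using this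
  have h2 := hm.eVariationOn_eq (left_mem_Icc.2 hab) (right_mem_Icc.2 hab)
  rw [inter_self] at h2
  refine h.trans ((mul_le_mul_right h2.le _).trans ?_)
  rw [← edist_nndist, edist_dist, ← ENNReal.ofReal_mul dist_nonneg]
  exact ENNReal.ofReal_le_ofReal (le_of_eq (by ring))

end Length

/-! ### The offline optimum lies strictly between 0 and ∞ -/

section Optimum

variable {u σ : ℝ}

/-- The route that walks straight to the near vertex and then along the short side. -/
noncomputable def shortRoute (u σ : ℝ) (t : ℝ) : Plane :=
  if t ≤ 1 / 2 then AffineMap.lineMap 0 (near σ) (2 * t)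
  else AffineMap.lineMap (near σ) (far u σ) (2 * t - 1)

lemma shortRoute_of_le {t : ℝ} (ht : t ≤ 1 / 2) :
    shortRoute u σ t = AffineMap.lineMap 0 (near σ) (2 * t) := if_pos ht

lemma shortRoute_of_ge {t : ℝ} (ht : 1 / 2 ≤ t) :
    shortRoute u σ t = AffineMap.lineMap (near σ) (far u σ) (2 * t - 1) := by
  rcases ht.eq_or_lt with rfl | h
  · rw [shortRoute_of_le le_rfl]; norm_num
  · exact if_neg h.not_ge

lemma continuous_shortRoute : Continuous (shortRoute u σ) := by
  unfold shortRoute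
  refine Continuous.if_le ?_ ?_ continuous_id continuous_const ?_
  · exact AffineMap.lineMap_continuous.comp (by fun_prop)
  · exact AffineMap.lineMap_continuous.comp (by fun_prop)
  · rintro t rfl; norm_num

lemma dist_zero_near (hσ : σ ^ 2 = 1) : dist 0 (near σ) = 1 := by
  rw [EuclideanSpace.dist_eq]
  simp [Fin.sum_univ_two, hσ]

lemma dist_near_far_sq (hσ : σ ^ 2 = 1) :
    dist (near σ) (far u σ) ^ 2 = 16 * u ^ 2 / (1 + u ^ 2) := by
  have : 1 + u ^ 2 ≠ 0 := by positivity
  rw [EuclideanSpace.dist_eq, Real.sq_sqrt (by positivity)]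
  simp only [Fin.sum_univ_two, Real.dist_eq, sq_abs, near_zero, near_one, far_zero, far_one]
  field_simp
  ring_nf
  rw [hσ]
  ring

lemma dist_near_far_le (hu : 0 < u) (hσ : σ ^ 2 = 1) : dist (near σ) (far u σ) ≤ 4 * u := by
  apply le_of_sq_le_sq _ (by positivity)
  rw [dist_near_far_sq hσ, div_le_iff₀ (by positivity)]
  nlinarith [sq_nonneg u, sq_nonneg (u ^ 2)]

lemma dist_apex_near (hσ : σ ^ 2 = 1) : dist (apex σ) (near σ) = 2 := by
  rw [EuclideanSpace.dist_eq, Real.sqrt_eq_iff_mul_self_eq (by positivity) (by positivity)]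
  simp only [Fin.sum_univ_two, Real.dist_eq, sq_abs, near_zero, near_one, apex_zero, apex_one]
  linear_combination 4 * hσ

lemma dist_apex_far (hσ : σ ^ 2 = 1) : dist (apex σ) (far u σ) = 2 := by
  have : 1 + u ^ 2 ≠ 0 := by positivity
  rw [EuclideanSpace.dist_eq, Real.sqrt_eq_iff_mul_self_eq (by positivity) (by positivity)]
  simp only [Fin.sum_univ_two, Real.dist_eq, sq_abs, far_zero, far_one, apex_zero, apex_one]
  field_simp
  ring_nf
  rw [hσ]
  ring

lemma pathLength_shortRoute_le (hu : 0 < u) (hσ : σ ^ 2 = 1) :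
    pathLength (shortRoute u σ) ≤ ENNReal.ofReal (1 + 4 * u) := by
  have hs := eVariationOn.Icc_add_Icc (shortRoute u σ) (s := univ) (a := 0) (b := 1 / 2) (c := 1)
    (by norm_num) (by norm_num) (mem_univ _)
  simp only [univ_inter] at hs
  rw [pathLength, ← hs, ENNReal.ofReal_add zero_le_one (by positivity)]
  apply add_le_add
  · have h := eVariationOn_lineMap_le 0 (near σ) (a := 0) (b := 1 / 2) (k := 2) (c := 0)
      (by norm_num) (by norm_num)
    rw [dist_zero_near hσ] at h
    rw [eVariationOn.congr (g := fun t => AffineMap.lineMap 0 (near σ) (2 * t + 0))]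
    · exact h.trans (ENNReal.ofReal_le_ofReal (by norm_num))
    · intro t ht; simp only [add_zero]; exact shortRoute_of_le ht.2
  · have h := eVariationOn_lineMap_le (near σ) (far u σ) (a := 1 / 2) (b := 1) (k := 2) (c := -1)
      (by norm_num) (by norm_num)
    rw [eVariationOn.congr (g := fun t => AffineMap.lineMap (near σ) (far u σ) (2 * t + -1))]
    · refine h.trans (ENNReal.ofReal_le_ofReal ?_)
      norm_num
      exact dist_near_far_le hu hσ
    · intro t ht; simp only [← sub_eq_add_neg]; exact shortRoute_of_ge ht.1

lemma isWatchmanRoute_shortRoute (hu : 0 < u) (hσ : σ ^ 2 = 1) :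
    (triangle u σ hu hσ).IsWatchmanRoute 0 (shortRoute u σ) := by
  have hbase : {v | 1 ≤ baseForm u σ v} ⊆ (triangle u σ hu hσ).free :=
    fun v hv => (mem_free_triangle hu hσ).2 (Or.inr (Or.inl hv))
  have hleg : {v | legForm u σ v ≤ 0} ⊆ (triangle u σ hu hσ).free :=
    fun v hv => (mem_free_triangle hu hσ).2 (Or.inr (Or.inr hv))
  have h0 : shortRoute u σ 0 = 0 := by rw [shortRoute_of_le (by norm_num)]; simp
  have h1 : shortRoute u σ 1 = far u σ := by rw [shortRoute_of_ge (by norm_num)]; norm_num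
  refine ⟨⟨continuous_shortRoute.continuousOn, fun t ht => ?_⟩, h0, ?_⟩
  · rcases le_total t (1 / 2) with h | h
    · rw [shortRoute_of_le h]
      exact upper_subset_free hu hσ ((convex_le_snd 0).lineMap_mem
        (by simp) near_one.ge ⟨by linarith [ht.1], by linarith⟩)
    · rw [shortRoute_of_ge h]
      exact hbase ((convex_le_baseForm 1).lineMap_mem (baseForm_near hσ).ge (baseForm_far hσ).ge
        ⟨by linarith, by linarith [ht.2]⟩)
  · apply Subset.antisymm (fun x hx => hx.1)
    intro x hx
    refine ⟨hx, ?_⟩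
    -- The free space is a union of three closed half-planes; the start sees the upper one and the
    -- far vertex sees the other two.
    rcases (mem_free_triangle hu hσ).1 hx with h | h | h
    · exact ⟨0, ⟨0, by simp, h0⟩, segment_inter_obstacle_eq_empty hu hσ (convex_le_snd 0)
        (upper_subset_free hu hσ) h (by simp)⟩
    · exact ⟨far u σ, ⟨1, by simp, h1⟩, segment_inter_obstacle_eq_empty hu hσ
        (convex_le_baseForm 1) hbase h (baseForm_far hσ).ge⟩
    · exact ⟨far u σ, ⟨1, by simp, h1⟩, segment_inter_obstacle_eq_empty hu hσ
        (convex_legForm_le 0) hleg h (legForm_far hσ).le⟩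

lemma opt_triangle_le (hu : 0 < u) (hσ : σ ^ 2 = 1) :
    opt (triangle u σ hu hσ) 0 ≤ ENNReal.ofReal (1 + 4 * u) :=
  (iInf₂_le _ (isWatchmanRoute_shortRoute hu hσ)).trans (pathLength_shortRoute_le hu hσ)

lemma opt_triangle_pos (hu : 0 < u) (hσ : σ ^ 2 = 1) : 0 < opt (triangle u σ hu hσ) 0 := by
  have hpos : 0 < ENNReal.ofReal (1 / √(1 + u ^ 2)) := by
    rw [ENNReal.ofReal_pos]; positivity
  refine hpos.trans_le (le_iInf₂ fun f hf => ?_)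
  obtain ⟨t, ht, hb⟩ := exists_one_le_baseForm hu hσ hf
  refine le_trans (ENNReal.ofReal_le_ofReal ?_)
    (ofReal_dist_add_dist_le_pathLength f le_rfl ht.1 ht.2)
  rw [dist_self, zero_add]
  apply div_le_dist (u := u) hσ
  rw [hf.2.1, abs_sub_comm]
  refine le_trans ?_ (le_abs_self _)
  simpa [baseForm] using hb

end Optimum

/-! ### The adversary argument -/

section Online

variable {u σ : ℝ}

lemma zero_mem_hiddenCone (hu : 0 < u) : (0 : Plane) ∈ hiddenCone u σ :=
  ⟨by simp [baseForm], by simp [legForm, hu]⟩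

/-- Two paths that agree before a time agree at that time. -/
lemma eq_of_eqOn_Ico {f g : ℝ → Plane} (hf : ContinuousOn f (Icc 0 1))
    (hg : ContinuousOn g (Icc 0 1)) {τ : ℝ} (h0 : 0 < τ) (h1 : τ ≤ 1)
    (h : EqOn f g (Ico 0 τ)) : f τ = g τ := by
  have hsub : Ico 0 τ ⊆ Icc 0 1 := fun t ht => ⟨ht.1, ht.2.le.trans h1⟩
  have hmem : τ ∈ closure (Ico 0 τ) := by rw [closure_Ico h0.ne]; exact ⟨h0.le, le_rfl⟩
  have := mem_closure_iff_nhdsWithin_neBot.1 hmem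
  have hf' := ((hf τ ⟨h0.le, h1⟩).mono hsub).tendsto
  have hg' := ((hg τ ⟨h0.le, h1⟩).mono hsub).tendsto
  exact tendsto_nhds_unique hf' (hg'.congr' (eventually_nhdsWithin_of_forall fun t ht => (h ht).symm))

/-- `τ` is the first time at which the path `f` may see the hidden vertex. -/
structure IsExitTime (u σ : ℝ) (f : ℝ → Plane) (τ : ℝ) : Prop where
  pos : 0 < τ
  le_one : τ ≤ 1
  mem_of_lt : ∀ t ∈ Ico 0 τ, f t ∈ hiddenCone u σ
  notMem : f τ ∉ hiddenCone u σ

lemma exists_isExitTime (hu : 0 < u) (hσ : σ ^ 2 = 1) {f : ℝ → Plane}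
    (hf : (triangle u σ hu hσ).IsWatchmanRoute 0 f) : ∃ τ, IsExitTime u σ f τ := by
  set T : Set ℝ := Icc 0 1 ∩ f ⁻¹' (hiddenCone u σ)ᶜ with hT
  have hTc : IsCompact T := isCompact_Icc.of_isClosed_subset
    (hf.1.1.preimage_isClosed_of_isClosed isClosed_Icc isOpen_hiddenCone.isClosed_compl)
    inter_subset_left
  have hTn : T.Nonempty := by
    obtain ⟨t, ht, hb⟩ := exists_one_le_baseForm hu hσ hf
    exact ⟨t, ht, fun hc => hc.1.not_ge hb⟩
  obtain ⟨τ, hτ, hmin⟩ := hTc.exists_isLeast hTn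
  refine ⟨τ, ?_, hτ.1.2, fun t ht => ?_, hτ.2⟩
  · rcases hτ.1.1.eq_or_lt with h | h
    · refine absurd ?_ hτ.2
      rw [← h, hf.2.1]
      exact zero_mem_hiddenCone hu
    · exact h
  · by_contra hc
    exact ht.2.not_ge (hmin ⟨⟨ht.1, ht.2.le.trans hτ.1.2⟩, hc⟩)

/-- Before the exit time an online route does not depend on the triangle. -/
lemma IsExitTime.eq_strategy {h : Plane → Set Plane → ℝ → Plane} (hu : 0 < u) (hσ : σ ^ 2 = 1)
    {f : ℝ → Plane} (hf : IsOnlineRoute h (triangle u σ hu hσ) 0 f) {τ : ℝ}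
    (hτ : IsExitTime u σ f τ) {t : ℝ} (ht : t ∈ Ico 0 τ) :
    f t = h 0 {apex σ, near σ} t := by
  rw [hf.2 t ⟨ht.1, ht.2.le.trans hτ.le_one⟩, seenVertices_eq hu hσ hf.1.2.1 ht.1]
  rintro _ ⟨r, hr, rfl⟩
  exact hτ.mem_of_lt r ⟨hr.1, hr.2.trans_lt ht.2⟩

/-- If `f'` left earlier, it would agree with `f` up to that moment by continuity, yet `f` is still
inside the cone there. -/
lemma IsExitTime.le_of_agree {f f' g : ℝ → Plane} (hf : ContinuousOn f (Icc 0 1))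
    (hf' : ContinuousOn f' (Icc 0 1)) {τ τ' : ℝ} (hτ : IsExitTime u σ f τ)
    (hτ' : IsExitTime u σ f' τ') (hg : EqOn f g (Ico 0 τ)) (hg' : EqOn f' g (Ico 0 τ')) :
    τ ≤ τ' := by
  by_contra! hlt
  refine hτ'.notMem ?_
  rw [eq_of_eqOn_Ico hf' hf hτ'.pos hτ'.le_one fun t ht =>
    (hg' ht).trans (hg ⟨ht.1, ht.2.trans hlt⟩).symm]
  exact hτ.mem_of_lt τ' ⟨hτ'.pos.le, hlt⟩

/-- Inside the cone the only free points are in the closed upper half-plane; this passes to the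
limit at τ. -/
lemma IsExitTime.snd_nonneg (hu : 0 < u) (hσ : σ ^ 2 = 1) {f : ℝ → Plane}
    (hf : (triangle u σ hu hσ).IsPath f) {τ : ℝ} (hτ : IsExitTime u σ f τ) : 0 ≤ f τ 1 := by
  have hsub : Ico 0 τ ⊆ Icc 0 1 := fun t ht => ⟨ht.1, ht.2.le.trans hτ.le_one⟩
  have hmem : τ ∈ closure (Ico 0 τ) := by
    rw [closure_Ico hτ.pos.ne]; exact ⟨hτ.pos.le, le_rfl⟩
  have hc : IsClosed {v : Plane | 0 ≤ v 1} :=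
    isClosed_le continuous_const (by fun_prop : Continuous fun v : Plane => v 1)
  have := ((hf.1 τ ⟨hτ.pos.le, hτ.le_one⟩).mono hsub).mem_closure (t := {v : Plane | 0 ≤ v 1})
    hmem fun t ht => ?_
  · rwa [hc.closure_eq] at this
  · have hW := hτ.mem_of_lt t ht
    rcases (mem_free_triangle hu hσ).1 (hf.2 (hsub ht)) with h | h | h
    · exact h
    · exact absurd h hW.1.not_ge
    · exact absurd h hW.2.not_ge

lemma IsExitTime.exists_later (hu : 0 < u) (hσ : σ ^ 2 = 1) {f : ℝ → Plane}
    (hf : (triangle u σ hu hσ).IsWatchmanRoute 0 f) {τ : ℝ} (hτ : IsExitTime u σ f τ) :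
    ∃ t, τ ≤ t ∧ t ≤ 1 ∧ 1 ≤ baseForm u σ (f t) := by
  obtain ⟨t, ht, hb⟩ := exists_one_le_baseForm hu hσ hf
  refine ⟨t, ?_, ht.2, hb⟩
  by_contra! hlt
  exact (hτ.mem_of_lt t ⟨ht.1, hlt⟩).1.not_ge hb

/-- A path that first goes a unit away from the origin, to a point at level at most `-1`, and then
reaches level `1`, is about three units long. -/
lemma three_div_le_pathLength (hσ : σ ^ 2 = 1) {f : ℝ → Plane} (h0 : f 0 = 0) {a b : ℝ}
    (ha : 0 ≤ a) (hab : a ≤ b) (hb : b ≤ 1) (hfa : baseForm u σ (f a) ≤ -1)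
    (hd : 1 / √(1 + u ^ 2) ≤ dist 0 (f a)) (hfb : 1 ≤ baseForm u σ (f b)) :
    ENNReal.ofReal (3 / √(1 + u ^ 2)) ≤ pathLength f := by
  refine le_trans (ENNReal.ofReal_le_ofReal ?_)
    (ofReal_dist_add_dist_le_pathLength f ha hab hb)
  have h2 : 2 / √(1 + u ^ 2) ≤ dist (f a) (f b) := by
    apply div_le_dist hσ
    rw [abs_sub_comm]
    exact le_trans (by linarith) (le_abs_self _)
  rw [h0]
  have : 3 / √(1 + u ^ 2) = 1 / √(1 + u ^ 2) + 2 / √(1 + u ^ 2) := by ring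
  linarith

/-- Since u < 1 the apex angle is acute, so in the upper half-plane crossing the hidden leg's line
means going past the apex. -/
lemma baseForm_le_neg_one_of_legForm (hu : 0 < u) (hu1 : u < 1) {p : Plane} (hp : 0 ≤ p 1)
    (h : legForm u σ p ≤ 0) : baseForm u σ p ≤ -1 := by
  simp only [legForm, baseForm] at *
  have h1 : 0 ≤ (1 - u ^ 2) * p 1 := mul_nonneg (by nlinarith) hp
  have h2 : σ * p 0 + 1 ≤ 0 := by
    by_contra! hc
    nlinarith [mul_pos hu hc]
  nlinarith [mul_nonneg hu.le hp]

lemma baseForm_neg_le (hu : 0 < u) {p : Plane} (hp : 0 ≤ p 1) :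
    baseForm u (-σ) p ≤ -baseForm u σ p := by
  simp only [baseForm]
  nlinarith [mul_nonneg hu.le hp]

/-- If the exit time for `σ` is at most the one for `-σ`, one of the two triangles forces every
online route to be long. -/
lemma exists_sign_of_le {h : Plane → Set Plane → ℝ → Plane} (hu : 0 < u) (hu1 : u < 1)
    (hσ : σ ^ 2 = 1) (hσ' : (-σ) ^ 2 = 1) {f f' : ℝ → Plane}
    (hf : IsOnlineRoute h (triangle u σ hu hσ) 0 f)
    (hf' : IsOnlineRoute h (triangle u (-σ) hu hσ') 0 f') {τ τ' : ℝ}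
    (hτ : IsExitTime u σ f τ) (hτ' : IsExitTime u (-σ) f' τ') (hle : τ ≤ τ') :
    ∃ (ρ : ℝ) (hρ : ρ ^ 2 = 1), ∀ k, IsOnlineRoute h (triangle u ρ hu hρ) 0 k →
      ENNReal.ofReal (3 / √(1 + u ^ 2)) ≤ pathLength k := by
  have hp := hτ.snd_nonneg hu hσ hf.1.1
  -- Reflection swaps the two ends of the shared side.
  have hab : ({apex (-σ), near (-σ)} : Set Plane) = {apex σ, near σ} := by
    rw [pair_comm]; simp [apex, near]
  have hexit : 1 ≤ |baseForm u σ (f τ)| := by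
    by_contra! hc
    rw [abs_lt] at hc
    refine hτ.notMem ⟨hc.2, ?_⟩
    by_contra! hl
    linarith [baseForm_le_neg_one_of_legForm hu hu1 hp hl]
  have hd : 1 / √(1 + u ^ 2) ≤ dist 0 (f τ) := by
    rw [dist_comm]
    apply div_le_dist hσ
    simpa [baseForm] using hexit
  have hgf : EqOn f (h 0 {apex σ, near σ}) (Ico 0 τ) := fun t ht => hτ.eq_strategy hu hσ hf ht
  -- The sign tells which end was approached; the triangle with its short side at the other end is
  -- chosen.
  rcases le_abs.1 hexit with hb | hb
  · refine ⟨-σ, hσ', fun k hk => ?_⟩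
    obtain ⟨κ, hκ⟩ := exists_isExitTime hu hσ' hk.1
    have hgk : EqOn k (h 0 {apex (-σ), near (-σ)}) (Ico 0 κ) :=
      fun t ht => hκ.eq_strategy hu hσ' hk ht
    have hle' : τ ≤ κ := hle.trans (hτ'.le_of_agree hf'.1.1.1 hk.1.1.1 hκ
      (fun t ht => hτ'.eq_strategy hu hσ' hf' ht) hgk)
    -- Continuity is needed because at τ itself the seen sets may already differ.
    have hkf : k τ = f τ := eq_of_eqOn_Ico hk.1.1.1 hf.1.1.1 hτ.pos hτ.le_one fun t ht => by
      rw [hgk ⟨ht.1, ht.2.trans_le hle'⟩, hgf ht, hab]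
    obtain ⟨t, ht, ht1, hbt⟩ := hκ.exists_later hu hσ' hk.1
    refine three_div_le_pathLength hσ' hk.1.2.1 hτ.pos.le (hle'.trans ht) ht1 ?_ ?_ hbt
    · rw [hkf]; linarith [baseForm_neg_le (σ := σ) hu hp]
    · rwa [hkf]
  · refine ⟨σ, hσ, fun k hk => ?_⟩
    obtain ⟨κ, hκ⟩ := exists_isExitTime hu hσ hk.1
    have hgk : EqOn k (h 0 {apex σ, near σ}) (Ico 0 κ) := fun t ht => hκ.eq_strategy hu hσ hk ht
    have hle' : τ ≤ κ := hτ.le_of_agree hf.1.1.1 hk.1.1.1 hκ hgf hgk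
    have hkf : k τ = f τ := eq_of_eqOn_Ico hk.1.1.1 hf.1.1.1 hτ.pos hτ.le_one fun t ht => by
      rw [hgk ⟨ht.1, ht.2.trans_le hle'⟩, hgf ht]
    obtain ⟨t, ht, ht1, hbt⟩ := hκ.exists_later hu hσ hk.1
    refine three_div_le_pathLength hσ hk.1.2.1 hτ.pos.le (hle'.trans ht) ht1 ?_ ?_ hbt
    · rw [hkf]; linarith
    · rwa [hkf]

lemma zero_mem_free (hu : 0 < u) (hσ : σ ^ 2 = 1) : (0 : Plane) ∈ (triangle u σ hu hσ).free :=
  upper_subset_free hu hσ (by simp)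

lemma exists_sign {h : Plane → Set Plane → ℝ → Plane} (hh : IsOnlineWatchmanAlgorithm h)
    (hu : 0 < u) (hu1 : u < 1) :
    ∃ (ρ : ℝ) (hρ : ρ ^ 2 = 1), ∀ k, IsOnlineRoute h (triangle u ρ hu hρ) 0 k →
      ENNReal.ofReal (3 / √(1 + u ^ 2)) ≤ pathLength k := by
  have h1 : (1 : ℝ) ^ 2 = 1 := one_pow 2
  have h2 : (-1 : ℝ) ^ 2 = 1 := by norm_num
  have h3 : (-(-1) : ℝ) ^ 2 = 1 := by norm_num
  obtain ⟨f, hf⟩ := hh (triangle u 1 hu h1) 0 (zero_mem_free hu h1)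
  obtain ⟨g, hg⟩ := hh (triangle u (-1) hu h2) 0 (zero_mem_free hu h2)
  obtain ⟨τ, hτ⟩ := exists_isExitTime hu h1 hf.1
  obtain ⟨τ', hτ'⟩ := exists_isExitTime hu h2 hg.1
  rcases le_total τ τ' with hle | hle
  · exact exists_sign_of_le hu hu1 h1 h2 hf hg hτ hτ' hle
  · refine exists_sign_of_le (f' := f) hu hu1 h2 h3 hg ?_ hτ' ?_ hle
    · simpa only [neg_neg] using hf
    · simpa only [neg_neg] using hτ

end Online

end Watchman

theorem mainTheorem3 (h : Watchman.Plane → Set Watchman.Plane → ℝ → Watchman.Plane)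
    (hh : Watchman.IsOnlineWatchmanAlgorithm h) (ε : ℝ) (hε : 0 < ε) :
    ∃ (O : Watchman.ConvexPolygon) (A B C s : Watchman.Plane),
      (O.vertices : Set Watchman.Plane) = {A, B, C} ∧
      dist A B = dist A C ∧ dist B C ≤ ε * dist A B ∧
      s ∈ O.free ∧
      0 < Watchman.opt O s ∧ Watchman.opt O s < ⊤ ∧
      (∃ f : ℝ → Watchman.Plane, Watchman.IsOnlineRoute h O s f) ∧
      ∀ f : ℝ → Watchman.Plane, Watchman.IsOnlineRoute h O s f →
        ENNReal.ofReal (3 - ε) < Watchman.pathLength f / Watchman.opt O s := by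
  -- For u < 1, (1+4u)√(1+u²) ≤ (1+4u)(1+u) ≤ 1+9u, and (3-ε)(1+9u) < 3 follows from 27u < ε.
  obtain ⟨u, hu, hu1, huε⟩ : ∃ u : ℝ, 0 < u ∧ u < 1 ∧ 27 * u < ε := by
    refine ⟨min (1 / 2) (ε / 28), by positivity, ?_, ?_⟩
    · exact (min_le_left _ _).trans_lt (by norm_num)
    · linarith [min_le_right (1 / 2) (ε / 28)]
  obtain ⟨σ, hσ, hlong⟩ := Watchman.exists_sign hh hu hu1
  have hfree := Watchman.zero_mem_free hu hσ
  have hpos := Watchman.opt_triangle_pos hu hσ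
  have hopt := Watchman.opt_triangle_le hu hσ
  have hfin := hopt.trans_lt ENNReal.ofReal_lt_top
  refine ⟨Watchman.triangle u σ hu hσ, Watchman.apex σ, Watchman.near σ, Watchman.far u σ, 0,
    Watchman.coe_vertices_triangle hu hσ, ?_, ?_, hfree, hpos, hfin, hh _ 0 hfree,
    fun f hf => ?_⟩
  · rw [Watchman.dist_apex_near hσ, Watchman.dist_apex_far hσ]
  · rw [Watchman.dist_apex_near hσ]
    linarith [Watchman.dist_near_far_le hu hσ]
  · rw [ENNReal.lt_div_iff_mul_lt (Or.inl hpos.ne') (Or.inl hfin.ne)]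
    refine lt_of_lt_of_le ?_ (hlong f hf)
    refine (mul_le_mul_right hopt _).trans_lt ?_
    have hsq : √(1 + u ^ 2) ≤ 1 + u := Real.sqrt_le_iff.2 ⟨by linarith, by nlinarith⟩
    have hsq0 : 0 < √(1 + u ^ 2) := by positivity
    rw [← ENNReal.ofReal_mul' (by positivity), ENNReal.ofReal_lt_ofReal_iff (by positivity),
      lt_div_iff₀ hsq0]
    -- The estimate multiplies inequalities by 3-ε, so the trivial case ε ≥ 3 is split off.
    rcases le_total (3 - ε) 0 with h3 | h3
    · have : (3 - ε) * (1 + 4 * u) * √(1 + u ^ 2) ≤ 0 :=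
        mul_nonpos_of_nonpos_of_nonneg
          (mul_nonpos_of_nonpos_of_nonneg h3 (by positivity)) hsq0.le
      linarith
    · calc (3 - ε) * (1 + 4 * u) * √(1 + u ^ 2)
          ≤ (3 - ε) * (1 + 4 * u) * (1 + u) := by gcongr
        _ ≤ (3 - ε) * (1 + 9 * u) := by
          rw [mul_assoc]
          exact mul_le_mul_of_nonneg_left (by nlinarith) h3
        _ < 3 := by nlinarith
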